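/- All Banach spaces are over a fixed scalar field $\mathbb K\in\{\mathbb R,\mathbb C\}$. For Banach spaces $U,V$ let $\mathcal A(U,V)$ be the Banach space of approximable operators, i.e. the closure, in the operator norm, of the bounded finite-rank operators $U\to V$, and let $\mathcal A(U)=\mathcal A(U,U)$, a Banach algebra under composition. Let $\widehat\otimes$ denote the completed projective tensor product. A Banach algebra $\mathcal B$ is called $K$-amenable if there is a net $(d_\alpha)$ in $\mathcal B\widehat\otimes\mathcal B$ with $\|d_\alpha\|\le K$ for all $\alpha$ such that $\pi(d_\alpha)a\to a$ and $a\cdot d_\alpha-d_\alpha\cdot a\to 0$ for every $a\in\mathcal B$, where $\pi(b\otimes c)=bc$, $a\cdot(b\otimes c)=ab\otimes c$ and $(b\otimes c)\cdot a=b\otimes ca$. The inversion constant of a bounded linear surjection $Q:E\to F$ of Banach spaces is $\|\widetilde Q^{-1}\|$, where $\widetilde Q:E/\ker Q\to F$ is the induced isomorphism. Let $X$ be a Banach space such that $\mathcal A(X)$ is $K$-amenable, let $P:X\to X$ be a bounded projection, and set $Y=\operatorname{rg}P$ and $Z=\operatorname{rg}(I-P)$. Then at least one of the product maps $$\pi_1:\mathcal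 A(Z,Y)\widehat\otimes\mathcal A(Y,Z)\to\mathcal A(Y),\qquad \pi_2:\mathcal A(Y,Z)\widehat\otimes\mathcal A(Z,Y)\to\mathcal A(Z),\qquad R\otimes S\mapsto RS,$$ is surjective with inversion constant at most $$4K\,\|P\|\,\|I-P\|\,\max\{\|P\|^3,\|I-P\|^3\}.$$ -/

import Mathlib

open scoped TensorProduct

noncomputable section

namespace ApproxOp

/-! ### The projective tensor product of two normed spaces -/

section Projective

variable (𝕜 : Type*) [RCLike 𝕜]
variable (E : Type*) [NormedAddCommGroup E] [NormedSpace 𝕜 E]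
variable (F : Type*) [NormedAddCommGroup F] [NormedSpace 𝕜 F]

/-- The algebraic tensor product `E ⊗ F`, as a type of its own that carries the projective norm. -/
def AlgTensor : Type _ := E ⊗[𝕜] F

instance : AddCommGroup (AlgTensor 𝕜 E F) := inferInstanceAs (AddCommGroup (E ⊗[𝕜] F))

instance : Module 𝕜 (AlgTensor 𝕜 E F) := inferInstanceAs (Module 𝕜 (E ⊗[𝕜] F))

variable {E F}

/-- The element `∑ xᵢ ⊗ yᵢ` given by a finite list of pairs `(xᵢ, yᵢ)`. -/
def tensorSum (l : List (E × F)) : AlgTensor 𝕜 E F :=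
  (l.map fun p => (p.1 ⊗ₜ[𝕜] p.2 : E ⊗[𝕜] F)).sum

/-- The cost `∑ ‖xᵢ‖ ‖yᵢ‖` of a finite list of pairs `(xᵢ, yᵢ)`. -/
def tensorCost (l : List (E × F)) : ℝ :=
  (l.map fun p => ‖p.1‖ * ‖p.2‖).sum

variable {𝕜}

/-- The projective norm: the infimum of `∑ ‖xᵢ‖ ‖yᵢ‖` over all representations
`t = ∑ xᵢ ⊗ yᵢ`. -/
def projNorm (t : AlgTensor 𝕜 E F) : ℝ :=
  ⨅ l : {l : List (E × F) // tensorSum 𝕜 l = t}, tensorCost l.1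

theorem tensorCost_nonneg (l : List (E × F)) : 0 ≤ tensorCost l := by
  refine List.sum_nonneg fun a ha => ?_
  obtain ⟨p, -, rfl⟩ := List.mem_map.1 ha
  positivity

theorem bddBelow_tensorCost (t : AlgTensor 𝕜 E F) :
    BddBelow (Set.range fun l : {l : List (E × F) // tensorSum 𝕜 l = t} => tensorCost l.1) :=
  ⟨0, by rintro _ ⟨l, rfl⟩; exact tensorCost_nonneg _⟩

theorem tensorSum_append (l m : List (E × F)) :
    tensorSum 𝕜 (l ++ m) = tensorSum 𝕜 l + tensorSum 𝕜 m := by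
  unfold tensorSum
  rw [List.map_append, List.sum_append]
  rfl

theorem tensorSum_smul (c : 𝕜) (l : List (E × F)) :
    tensorSum 𝕜 (l.map fun p => (c • p.1, p.2)) = c • tensorSum 𝕜 l := by
  induction l with
  | nil => exact (smul_zero (A := AlgTensor 𝕜 E F) c).symm
  | cons p l ih =>
    have h1 : tensorSum 𝕜 ((p :: l).map fun p => (c • p.1, p.2))
        = tensorSum 𝕜 [(c • p.1, p.2)] + tensorSum 𝕜 (l.map fun p => (c • p.1, p.2)) :=
      tensorSum_append [(c • p.1, p.2)] _
    have h2 : tensorSum 𝕜 (p :: l) = tensorSum 𝕜 [p] + tensorSum 𝕜 l := tensorSum_append [p] l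
    have h3 : tensorSum 𝕜 [(c • p.1, p.2)] = c • tensorSum 𝕜 [p] := by
      have : (((c • p.1) ⊗ₜ[𝕜] p.2 : E ⊗[𝕜] F) + 0) = c • ((p.1 ⊗ₜ[𝕜] p.2 : E ⊗[𝕜] F) + 0) := by
        rw [add_zero, add_zero, TensorProduct.smul_tmul']
      exact this
    rw [h1, h2, ih, h3, smul_add]

theorem exists_tensorSum (t : AlgTensor 𝕜 E F) : ∃ l : List (E × F), tensorSum 𝕜 l = t := by
  refine TensorProduct.induction_on (R := 𝕜) (M := E) (N := F)
    (motive := fun t => ∃ l : List (E × F), tensorSum 𝕜 l = t) t ⟨[], rfl⟩ ?_ ?_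
  · intro x y
    exact ⟨[(x, y)], add_zero (x ⊗ₜ[𝕜] y : E ⊗[𝕜] F)⟩
  · rintro x y ⟨l, rfl⟩ ⟨m, rfl⟩
    exact ⟨l ++ m, tensorSum_append l m⟩

instance (t : AlgTensor 𝕜 E F) : Nonempty {l : List (E × F) // tensorSum 𝕜 l = t} :=
  let ⟨l, hl⟩ := exists_tensorSum t
  ⟨⟨l, hl⟩⟩

theorem projNorm_le_cost (l : List (E × F)) : projNorm (tensorSum 𝕜 l) ≤ tensorCost l :=
  ciInf_le (bddBelow_tensorCost _) ⟨l, rfl⟩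

theorem projNorm_zero : projNorm (0 : AlgTensor 𝕜 E F) = 0 :=
  le_antisymm (projNorm_le_cost (𝕜 := 𝕜) ([] : List (E × F)))
    (le_ciInf fun l => tensorCost_nonneg l.1)

theorem projNorm_add_le (s t : AlgTensor 𝕜 E F) :
    projNorm (s + t) ≤ projNorm s + projNorm t := by
  refine le_ciInf_add_ciInf fun l m => ?_
  have h : tensorSum 𝕜 (l.1 ++ m.1) = s + t := by rw [tensorSum_append, l.2, m.2]
  refine (ciInf_le (bddBelow_tensorCost _) ⟨l.1 ++ m.1, h⟩).trans (le_of_eq ?_)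
  simp [tensorCost]

theorem projNorm_smul_le (c : 𝕜) (t : AlgTensor 𝕜 E F) :
    projNorm (c • t) ≤ ‖c‖ * projNorm t := by
  unfold projNorm
  rw [Real.mul_iInf_of_nonneg (norm_nonneg _)]
  refine le_ciInf fun l => ?_
  have h : tensorSum 𝕜 (l.1.map fun p => (c • p.1, p.2)) = c • t := by
    rw [tensorSum_smul, l.2]
  refine (ciInf_le (bddBelow_tensorCost _) ⟨_, h⟩).trans (le_of_eq ?_)
  simp [tensorCost, Function.comp_def, norm_smul, mul_assoc, List.sum_map_mul_left]

variable (𝕜 E F) in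
/-- The projective norm as a seminorm on `E ⊗ F`. -/
def projSeminorm : Seminorm 𝕜 (AlgTensor 𝕜 E F) :=
  .ofSMulLE projNorm projNorm_zero projNorm_add_le projNorm_smul_le

instance : SeminormedAddCommGroup (AlgTensor 𝕜 E F) :=
  fast_instance% AddGroupSeminorm.toSeminormedAddCommGroup (projSeminorm 𝕜 E F).toAddGroupSeminorm

instance : NormedSpace 𝕜 (AlgTensor 𝕜 E F) := ⟨projNorm_smul_le⟩

variable (𝕜 E F) in
/-- The (completed) projective tensor product `E ⊗̂ F`: the completion of `E ⊗ F` for the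
projective norm. -/
def ProjTensor : Type _ := UniformSpace.Completion (AlgTensor 𝕜 E F)

instance : NormedAddCommGroup (ProjTensor 𝕜 E F) :=
  inferInstanceAs (NormedAddCommGroup (UniformSpace.Completion (AlgTensor 𝕜 E F)))

instance : NormedSpace 𝕜 (ProjTensor 𝕜 E F) :=
  inferInstanceAs (NormedSpace 𝕜 (UniformSpace.Completion (AlgTensor 𝕜 E F)))

instance : CompleteSpace (ProjTensor 𝕜 E F) :=
  inferInstanceAs (CompleteSpace (UniformSpace.Completion (AlgTensor 𝕜 E F)))

variable (𝕜 E F) in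
/-- The canonical (isometric, dense) map `E ⊗ F → E ⊗̂ F`. -/
def toProj : AlgTensor 𝕜 E F →L[𝕜] ProjTensor 𝕜 E F :=
  UniformSpace.Completion.toComplL (𝕜 := 𝕜) (E := AlgTensor 𝕜 E F)

theorem denseRange_toProj : DenseRange (toProj 𝕜 E F) :=
  UniformSpace.Completion.denseRange_coe (α := AlgTensor 𝕜 E F)

theorem isUniformInducing_toProj : IsUniformInducing (toProj 𝕜 E F) :=
  UniformSpace.Completion.isUniformInducing_coe (AlgTensor 𝕜 E F)

theorem norm_toProj (t : AlgTensor 𝕜 E F) : ‖toProj 𝕜 E F t‖ = projNorm t :=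
  UniformSpace.Completion.norm_coe (E := AlgTensor 𝕜 E F) t

variable (𝕜 E F) in
/-- The canonical bilinear map `E × F → E ⊗ F`. -/
def algMk : E →ₗ[𝕜] F →ₗ[𝕜] AlgTensor 𝕜 E F := TensorProduct.mk 𝕜 E F

theorem tensorSum_singleton (x : E) (y : F) : tensorSum 𝕜 [(x, y)] = algMk 𝕜 E F x y :=
  add_zero (x ⊗ₜ[𝕜] y : E ⊗[𝕜] F)

variable (𝕜) in
/-- The elementary tensor `x ⊗ y` in `E ⊗̂ F`. -/
def ptmul (x : E) (y : F) : ProjTensor 𝕜 E F := toProj 𝕜 E F (algMk 𝕜 E F x y)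

variable {G : Type*} [NormedAddCommGroup G] [NormedSpace 𝕜 G]

/-- The linear map on `E ⊗ F` induced by a bounded bilinear map. -/
def algLift (B : E →L[𝕜] F →L[𝕜] G) : AlgTensor 𝕜 E F →ₗ[𝕜] G :=
  TensorProduct.lift (B.toLinearMap₁₂ : E →ₗ[𝕜] F →ₗ[𝕜] G)

theorem algLift_tensorSum (B : E →L[𝕜] F →L[𝕜] G) (l : List (E × F)) :
    algLift B (tensorSum 𝕜 l) = (l.map fun p => B p.1 p.2).sum := by
  induction l with
  | nil => exact map_zero (algLift B)
  | cons p l ih =>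
    have h : tensorSum 𝕜 (p :: l) = tensorSum 𝕜 [p] + tensorSum 𝕜 l := tensorSum_append [p] l
    have h1 : algLift B (tensorSum 𝕜 [p]) = B p.1 p.2 := by
      have : TensorProduct.lift (B.toLinearMap₁₂ : E →ₗ[𝕜] F →ₗ[𝕜] G)
          ((p.1 ⊗ₜ[𝕜] p.2 : E ⊗[𝕜] F) + 0) = B p.1 p.2 := by
        rw [add_zero, TensorProduct.lift.tmul]; rfl
      exact this
    rw [h, map_add, ih, h1, List.map_cons, List.sum_cons]

theorem norm_algLift_le (B : E →L[𝕜] F →L[𝕜] G) (t : AlgTensor 𝕜 E F) :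
    ‖algLift B t‖ ≤ ‖B‖ * ‖t‖ := by
  change ‖algLift B t‖ ≤ ‖B‖ * projNorm t
  unfold projNorm
  rw [Real.mul_iInf_of_nonneg (norm_nonneg B)]
  refine le_ciInf ?_
  rintro ⟨l, rfl⟩
  rw [algLift_tensorSum]
  induction l with
  | nil => simp [tensorCost]
  | cons p l ih =>
    have h := B.le_opNorm₂ p.1 p.2
    simp only [tensorCost, List.map_cons, List.sum_cons] at ih ⊢
    calc _ ≤ ‖B p.1 p.2‖ + ‖(l.map fun p => B p.1 p.2).sum‖ := norm_add_le _ _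
      _ ≤ _ := by rw [mul_add, ← mul_assoc]; exact add_le_add h ih

/-- The bounded linear map `E ⊗̂ F → G` into a Banach space `G` induced by a bounded bilinear map
`B : E × F → G`; it sends `x ⊗ y` to `B x y`. -/
def lift [CompleteSpace G] (B : E →L[𝕜] F →L[𝕜] G) : ProjTensor 𝕜 E F →L[𝕜] G :=
  ((algLift B).mkContinuous ‖B‖ (norm_algLift_le B)).extend (toProj 𝕜 E F)

theorem lift_ptmul [CompleteSpace G] (B : E →L[𝕜] F →L[𝕜] G) (x : E) (y : F) :
    lift B (ptmul 𝕜 x y) = B x y :=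
  (ContinuousLinearMap.extend_eq _ denseRange_toProj isUniformInducing_toProj _).trans
    (TensorProduct.lift.tmul (R := 𝕜) x y)

theorem norm_ptmul_le (x : E) (y : F) : ‖ptmul 𝕜 x y‖ ≤ ‖x‖ * ‖y‖ := by
  have h := projNorm_le_cost (𝕜 := 𝕜) [(x, y)]
  rw [tensorSum_singleton] at h
  rw [ptmul, norm_toProj]
  simpa [tensorCost] using h

variable (𝕜 E F) in
/-- The canonical bounded bilinear map `E × F → E ⊗̂ F`, `(x, y) ↦ x ⊗ y`. -/
def ptmulL : E →L[𝕜] F →L[𝕜] ProjTensor 𝕜 E F :=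
  LinearMap.mkContinuous₂ ((algMk 𝕜 E F).compr₂ (toProj 𝕜 E F : AlgTensor 𝕜 E F →ₗ[𝕜] _))
    1 fun x y => by rw [one_mul]; exact norm_ptmul_le x y

theorem ptmulL_apply (x : E) (y : F) : ptmulL 𝕜 E F x y = ptmul 𝕜 x y := rfl

end Projective

/-! ### Amenability -/

section Amenable

variable (𝕜 : Type*) [RCLike 𝕜]
variable {A : Type*} [NonUnitalNormedRing A] [NormedSpace 𝕜 A] [IsScalarTower 𝕜 A A]
  [SMulCommClass 𝕜 A A]

/-- The left action `a · (b ⊗ c) = ab ⊗ c` of `A` on `A ⊗̂ A`. -/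
def leftAct (a : A) : ProjTensor 𝕜 A A →L[𝕜] ProjTensor 𝕜 A A :=
  lift ((ptmulL 𝕜 A A).comp (ContinuousLinearMap.mul 𝕜 A a))

/-- The right action `(b ⊗ c) · a = b ⊗ ca` of `A` on `A ⊗̂ A`. -/
def rightAct (a : A) : ProjTensor 𝕜 A A →L[𝕜] ProjTensor 𝕜 A A :=
  lift ((ptmulL 𝕜 A A).bilinearComp (.id 𝕜 A) ((ContinuousLinearMap.mul 𝕜 A).flip a))

variable (A) in
/-- The product map `π : A ⊗̂ A → A`, `a ⊗ b ↦ ab`. -/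
def mulMap [CompleteSpace A] : ProjTensor 𝕜 A A →L[𝕜] A :=
  lift (ContinuousLinearMap.mul 𝕜 A)

theorem leftAct_ptmul (a b c : A) : leftAct 𝕜 a (ptmul 𝕜 b c) = ptmul 𝕜 (a * b) c :=
  lift_ptmul _ b c

theorem rightAct_ptmul (a b c : A) : rightAct 𝕜 a (ptmul 𝕜 b c) = ptmul 𝕜 b (c * a) :=
  lift_ptmul _ b c

end Amenable

/-- The Banach algebra `A` is `K`-amenable: it has an approximate diagonal of bound `K`, i.e. a net
`(d i)` in `A ⊗̂ A` with `‖d i‖ ≤ K`, `π (d i) a → a` and `a · d i - d i · a → 0` for all `a`. -/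
def IsKAmenable.{u, v} (𝕜 : Type u) [RCLike 𝕜] (A : Type v) [NonUnitalNormedRing A]
    [NormedSpace 𝕜 A] [IsScalarTower 𝕜 A A] [SMulCommClass 𝕜 A A] [CompleteSpace A]
    (K : ℝ) : Prop :=
  ∃ (ι : Type v) (_ : Preorder ι) (_ : IsDirectedOrder ι) (_ : Nonempty ι)
    (d : ι → ProjTensor 𝕜 A A),
    (∀ i, ‖d i‖ ≤ K) ∧
    (∀ a : A, Filter.Tendsto (fun i => mulMap 𝕜 A (d i) * a) Filter.atTop (nhds a)) ∧
    (∀ a : A, Filter.Tendsto (fun i => leftAct 𝕜 a (d i) - rightAct 𝕜 a (d i)) Filter.atTop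
      (nhds 0))

/-! ### Approximable operators -/

section Approximable

variable (𝕜 : Type*) [RCLike 𝕜]
variable (X : Type*) [NormedAddCommGroup X] [NormedSpace 𝕜 X]
variable (Y : Type*) [NormedAddCommGroup Y] [NormedSpace 𝕜 Y]
variable (Z : Type*) [NormedAddCommGroup Z] [NormedSpace 𝕜 Z]

/-- The space `F(X, Y)` of bounded finite-rank operators. -/
def finiteRank : Submodule 𝕜 (X →L[𝕜] Y) where
  carrier := {T | FiniteDimensional 𝕜 (LinearMap.range (T : X →ₗ[𝕜] Y))}
  zero_mem' := by
    have h : LinearMap.range ((0 : X →L[𝕜] Y) : X →ₗ[𝕜] Y) = ⊥ := by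
      rw [ContinuousLinearMap.toLinearMap_zero, LinearMap.range_zero]
    simp only [Set.mem_ofPred_eq]
    rw [h]
    infer_instance
  add_mem' := by
    intro S T hS hT
    simp only [Set.mem_ofPred_eq] at hS hT ⊢
    refine Submodule.finiteDimensional_of_le (S₂ := LinearMap.range (S : X →ₗ[𝕜] Y) ⊔
      LinearMap.range (T : X →ₗ[𝕜] Y)) ?_
    rintro _ ⟨x, rfl⟩
    exact Submodule.add_mem_sup ⟨x, rfl⟩ ⟨x, rfl⟩
  smul_mem' := by
    intro c T hT
    simp only [Set.mem_ofPred_eq] at hT ⊢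
    refine Submodule.finiteDimensional_of_le (S₂ := LinearMap.range (T : X →ₗ[𝕜] Y)) ?_
    rintro _ ⟨x, rfl⟩
    exact Submodule.smul_mem _ c ⟨x, rfl⟩

/-- The space `A(X, Y)` of approximable operators: the operator norm closure of `F(X, Y)`. -/
def approximable : Submodule 𝕜 (X →L[𝕜] Y) := (finiteRank 𝕜 X Y).topologicalClosure

variable {𝕜 X Y Z}

theorem comp_mem_approximable_left (R : Y →L[𝕜] Z) {S : X →L[𝕜] Y}
    (hS : S ∈ approximable 𝕜 X Y) : R.comp S ∈ approximable 𝕜 X Z := by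
  have hc : Continuous fun S : X →L[𝕜] Y => R.comp S :=
    (ContinuousLinearMap.compL 𝕜 X Y Z R).continuous
  refine map_mem_closure hc hS fun S hS => ?_
  have hS' : FiniteDimensional 𝕜 (LinearMap.range (S : X →ₗ[𝕜] Y)) := hS
  change FiniteDimensional 𝕜 (LinearMap.range ((R : Y →ₗ[𝕜] Z) ∘ₗ (S : X →ₗ[𝕜] Y)))
  rw [LinearMap.range_comp]
  infer_instance

variable (𝕜 X Y) in
/-- The Banach space `A(X, Y)` of approximable operators with the operator norm, as a type. -/
def Approx : Type _ := approximable 𝕜 X Y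

instance : NormedAddCommGroup (Approx 𝕜 X Y) :=
  inferInstanceAs (NormedAddCommGroup (approximable 𝕜 X Y))

instance : NormedSpace 𝕜 (Approx 𝕜 X Y) :=
  inferInstanceAs (NormedSpace 𝕜 (approximable 𝕜 X Y))

instance [CompleteSpace Y] : CompleteSpace (Approx 𝕜 X Y) :=
  (Submodule.isClosed_topologicalClosure (finiteRank 𝕜 X Y)).completeSpace_coe

variable (𝕜 X Y) in
/-- The isometric inclusion of `A(X, Y)` into the bounded operators. -/
def Approx.val : Approx 𝕜 X Y →ₗᵢ[𝕜] (X →L[𝕜] Y) := (approximable 𝕜 X Y).subtypeₗᵢ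

theorem Approx.val_injective : Function.Injective (Approx.val 𝕜 X Y) :=
  (Approx.val 𝕜 X Y).injective

/-- Composition of approximable operators. -/
def Approx.comp (R : Approx 𝕜 Y Z) (S : Approx 𝕜 X Y) : Approx 𝕜 X Z :=
  ⟨(Approx.val 𝕜 Y Z R).comp (Approx.val 𝕜 X Y S), comp_mem_approximable_left _ S.2⟩

theorem Approx.val_comp (R : Approx 𝕜 Y Z) (S : Approx 𝕜 X Y) :
    Approx.val 𝕜 X Z (R.comp S) = (Approx.val 𝕜 Y Z R).comp (Approx.val 𝕜 X Y S) := rfl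

/-- `A(X) = A(X, X)` is a Banach algebra, with composition as multiplication. -/
instance : NonUnitalNormedRing (Approx 𝕜 X X) where
  __ := (inferInstance : NormedAddCommGroup (Approx 𝕜 X X))
  mul := Approx.comp
  left_distrib R S T := Approx.val_injective <| by
    change Approx.val 𝕜 X X (R.comp (S + T)) = Approx.val 𝕜 X X (R.comp S + R.comp T)
    simp [Approx.val_comp]
  right_distrib R S T := Approx.val_injective <| by
    change Approx.val 𝕜 X X ((R + S).comp T) = Approx.val 𝕜 X X (R.comp T + S.comp T)
    simp [Approx.val_comp]
  zero_mul R := Approx.val_injective <| by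
    change Approx.val 𝕜 X X (Approx.comp 0 R) = Approx.val 𝕜 X X 0
    simp [Approx.val_comp]
  mul_zero R := Approx.val_injective <| by
    change Approx.val 𝕜 X X (Approx.comp R 0) = Approx.val 𝕜 X X 0
    simp [Approx.val_comp]
  mul_assoc _ _ _ := rfl
  norm_mul_le R S := ContinuousLinearMap.opNorm_comp_le R.1 S.1

theorem Approx.mul_eq_comp (R S : Approx 𝕜 X X) : R * S = R.comp S := rfl

instance : IsScalarTower 𝕜 (Approx 𝕜 X X) (Approx 𝕜 X X) where
  smul_assoc c R S := Approx.val_injective <| by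
    rw [smul_eq_mul, smul_eq_mul, map_smul, Approx.mul_eq_comp, Approx.mul_eq_comp,
      Approx.val_comp, Approx.val_comp, map_smul, ContinuousLinearMap.smul_comp]

instance : SMulCommClass 𝕜 (Approx 𝕜 X X) (Approx 𝕜 X X) where
  smul_comm c R S := Approx.val_injective <| by
    rw [smul_eq_mul, smul_eq_mul, map_smul, Approx.mul_eq_comp, Approx.mul_eq_comp,
      Approx.val_comp, Approx.val_comp, map_smul, ContinuousLinearMap.comp_smul]

variable (𝕜 Y Z) in
/-- Composition `(R, S) ↦ R ∘ S` as a bounded bilinear map `A(Z, Y) × A(Y, Z) → A(Y)`. -/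
def compApprox : Approx 𝕜 Z Y →L[𝕜] Approx 𝕜 Y Z →L[𝕜] Approx 𝕜 Y Y :=
  LinearMap.mkContinuous₂
    (LinearMap.mk₂ 𝕜 Approx.comp
      (fun R R' S => Approx.val_injective (by simp [Approx.val_comp]))
      (fun c R S => Approx.val_injective (by simp [Approx.val_comp]))
      (fun R S S' => Approx.val_injective (by simp [Approx.val_comp]))
      (fun c R S => Approx.val_injective (by simp [Approx.val_comp])))
    1 fun R S => by
      rw [one_mul, LinearMap.mk₂_apply, ← (Approx.val 𝕜 Y Y).norm_map,
        ← (Approx.val 𝕜 Z Y).norm_map, ← (Approx.val 𝕜 Y Z).norm_map, Approx.val_comp]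
      exact ContinuousLinearMap.opNorm_comp_le _ _

variable (𝕜 Y Z) in
/-- The product map `π : A(Z, Y) ⊗̂ A(Y, Z) → A(Y)`, `R ⊗ S ↦ R ∘ S`. -/
def productMap [CompleteSpace Y] :
    ProjTensor 𝕜 (Approx 𝕜 Z Y) (Approx 𝕜 Y Z) →L[𝕜] Approx 𝕜 Y Y :=
  lift (compApprox 𝕜 Y Z)

theorem productMap_ptmul [CompleteSpace Y] (R : Approx 𝕜 Z Y) (S : Approx 𝕜 Y Z) :
    productMap 𝕜 Y Z (ptmul 𝕜 R S) = R.comp S :=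
  lift_ptmul (compApprox 𝕜 Y Z) R S

end Approximable

/-! ### Inversion constants, and ranges of projections -/

section Inversion

variable {𝕜 : Type*} [RCLike 𝕜]
variable {E : Type*} [NormedAddCommGroup E] [NormedSpace 𝕜 E] [CompleteSpace E]
variable {F : Type*} [NormedAddCommGroup F] [NormedSpace 𝕜 F] [CompleteSpace F]

/-- The inverse `F → E ⧸ ker Q` of the linear isomorphism induced by a bounded surjection
`Q : E → F` of Banach spaces; it is bounded by the open mapping theorem. -/
def quotientInverse (Q : E →L[𝕜] F) (hQ : Function.Surjective Q) :
    F →L[𝕜] E ⧸ LinearMap.ker (Q : E →ₗ[𝕜] F) :=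
  LinearMap.mkContinuousOfExistsBound
    ((Q : E →ₗ[𝕜] F).quotKerEquivOfSurjective hQ).symm.toLinearMap <| by
      obtain ⟨C, -, hC⟩ := Q.exists_preimage_norm_le hQ
      refine ⟨C, fun y => ?_⟩
      obtain ⟨x, rfl, hx⟩ := hC y
      have h : ((Q : E →ₗ[𝕜] F).quotKerEquivOfSurjective hQ).symm (Q x) = Submodule.Quotient.mk x :=
        (Q : E →ₗ[𝕜] F).quotKerEquivOfSurjective_symm_apply hQ x
      change ‖((Q : E →ₗ[𝕜] F).quotKerEquivOfSurjective hQ).symm (Q x)‖ ≤ _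
      rw [h]
      exact (Submodule.Quotient.norm_mk_le _ x).trans hx

/-- The inversion constant of a bounded surjection `Q : E → F` of Banach spaces: the operator norm
of the inverse of the induced isomorphism `E ⧸ ker Q → F`. -/
def inversionConstant (Q : E →L[𝕜] F) (hQ : Function.Surjective Q) : ℝ :=
  ‖quotientInverse Q hQ‖

/-- The range of a bounded linear map, as a normed space. -/
abbrev rg (P : E →L[𝕜] E) : Submodule 𝕜 E := LinearMap.range (P : E →ₗ[𝕜] E)

theorem completeSpace_rg {P : E →L[𝕜] E} (hP : IsIdempotentElem P) : CompleteSpace (rg P) := by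
  have h : (rg P : Set E) = {x | P x = x} := by
    ext x
    constructor
    · rintro ⟨y, rfl⟩
      exact DFunLike.congr_fun hP.eq y
    · intro hx
      exact ⟨x, hx⟩
  have hc : IsClosed (rg P : Set E) := by
    rw [h]
    exact isClosed_eq P.continuous continuous_id
  exact hc.completeSpace_coe

end Inversion

end ApproxOp

end

/-!
Let `(dₙ)` be a bounded approximate diagonal of `A(X)`. For a bounded operator `T` on `X`, applying
`R ⊗ S ↦ R T S` to `dₙ` yields bounded operators `Mₙ(T)` that asymptotically commute with all
rank-one operators; hence, along an ultrafilter, they converge strongly to a scalar `c(T)`. Since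
`Mₙ(1) = π(dₙ)` converges strongly to the identity, `c(Q) + c(1 - Q) = 1`, where `Q = 1 - P`, so one
of the two scalars has modulus at least `1/2`. If it is `c(Q)` and `a ∈ A(Y)`, then
`c(Q)⁻¹ P Mₙ(Q) a → a` in norm, because strong convergence of a bounded net becomes norm convergence
after composition with an approximable operator. As `Q` factors through `Z`, the left-hand side is
the image under `A(Z, Y) ⊗̂ A(Y, Z) → A(Y)` of a tensor whose norm is controlled by `‖a‖`, and a
successive approximation turns approximate preimages into exact ones. The case of `c(P)` is
symmetric.
-/

noncomputable section

namespace ApproxOp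

open Filter
open scoped Topology

section Projective

variable {𝕜 : Type*} [RCLike 𝕜]
variable {E : Type*} [NormedAddCommGroup E] [NormedSpace 𝕜 E]
variable {F : Type*} [NormedAddCommGroup F] [NormedSpace 𝕜 F]
variable {G : Type*} [NormedAddCommGroup G] [NormedSpace 𝕜 G]
variable {H : Type*} [NormedAddCommGroup H] [NormedSpace 𝕜 H]

theorem ProjTensor.clm_ext {f g : ProjTensor 𝕜 E F →L[𝕜] G}
    (h : ∀ x y, f (ptmul 𝕜 x y) = g (ptmul 𝕜 x y)) : f = g := by
  have h_alg : (f.comp (toProj 𝕜 E F)).toLinearMap = (g.comp (toProj 𝕜 E F)).toLinearMap :=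
    TensorProduct.ext' h
  exact ContinuousLinearMap.coeFn_injective <| denseRange_toProj.equalizer f.continuous g.continuous
    (congrArg DFunLike.coe h_alg)

theorem lift_toProj [CompleteSpace G] (B : E →L[𝕜] F →L[𝕜] G) (t : AlgTensor 𝕜 E F) :
    lift B (toProj 𝕜 E F t) = algLift B t :=
  ContinuousLinearMap.extend_eq _ denseRange_toProj isUniformInducing_toProj _

theorem norm_lift_le [CompleteSpace G] (B : E →L[𝕜] F →L[𝕜] G) : ‖lift B‖ ≤ ‖B‖ := by
  refine ContinuousLinearMap.opNorm_le_bound _ (norm_nonneg B) fun t => ?_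
  refine denseRange_toProj.induction_on t (isClosed_le (by fun_prop) (by fun_prop)) fun s => ?_
  rw [lift_toProj, norm_toProj]
  exact norm_algLift_le B s

/-- The tensor product `f ⊗̂ g` of bounded linear maps, sending `x ⊗ y` to `f x ⊗ g y`. -/
def ProjTensor.map (f : E →L[𝕜] G) (g : F →L[𝕜] H) : ProjTensor 𝕜 E F →L[𝕜] ProjTensor 𝕜 G H :=
  lift ((ptmulL 𝕜 G H).bilinearComp f g)

theorem ProjTensor.map_ptmul (f : E →L[𝕜] G) (g : F →L[𝕜] H) (x : E) (y : F) :
    ProjTensor.map f g (ptmul 𝕜 x y) = ptmul 𝕜 (f x) (g y) :=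
  lift_ptmul _ x y

theorem ProjTensor.norm_map_le (f : E →L[𝕜] G) (g : F →L[𝕜] H) :
    ‖ProjTensor.map f g‖ ≤ ‖f‖ * ‖g‖ := by
  refine (norm_lift_le _).trans ?_
  refine ContinuousLinearMap.opNorm_le_bound₂ _ (by positivity) fun x y => ?_
  calc ‖ptmul 𝕜 (f x) (g y)‖ ≤ ‖f x‖ * ‖g y‖ := norm_ptmul_le _ _
    _ ≤ (‖f‖ * ‖x‖) * (‖g‖ * ‖y‖) := by gcongr <;> exact ContinuousLinearMap.le_opNorm _ _
    _ = ‖f‖ * ‖g‖ * ‖x‖ * ‖y‖ := by ring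

end Projective

section Inversion

theorem surjective_of_mem_closure_image_closedBall {𝕜 : Type*} [NormedField 𝕜]
    {E : Type*} [NormedAddCommGroup E] [NormedSpace 𝕜 E] [CompleteSpace E]
    {F : Type*} [NormedAddCommGroup F] [NormedSpace 𝕜 F] {Q : E →L[𝕜] F} {C : ℝ}
    (hQ : ∀ y, y ∈ closure (Q '' Metric.closedBall 0 (C * ‖y‖))) : Function.Surjective Q := by
  have h_half (y : F) : ∃ x, ‖x‖ ≤ C * ‖y‖ ∧ ‖y - Q x‖ ≤ 1 / 2 * ‖y‖ := by
    rcases eq_or_ne y 0 with rfl | hy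
    · exact ⟨0, by simp⟩
    · obtain ⟨_, ⟨x, hx, rfl⟩, hyx⟩ :=
        Metric.mem_closure_iff.1 (hQ y) (1 / 2 * ‖y‖) (by positivity)
      exact ⟨x, mem_closedBall_zero_iff.1 hx, dist_eq_norm y (Q x) ▸ hyx.le⟩
  choose g hg_norm hg_half using h_half
  intro y
  let r (n : ℕ) : F := (fun z => z - Q (g z))^[n] y
  have hr_succ (n : ℕ) : r (n + 1) = r n - Q (g (r n)) := Function.iterate_succ_apply' _ _ _
  have hr_norm (n : ℕ) : ‖r n‖ ≤ (1 / 2) ^ n * ‖y‖ := by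
    induction n with
    | zero => simp [r]
    | succ n ih =>
      rw [hr_succ, pow_succ']
      linarith [hg_half (r n)]
  have hr_summable : Summable fun n => ‖r n‖ :=
    .of_nonneg_of_le (fun _ => norm_nonneg _) hr_norm (summable_geometric_two.mul_right _)
  have hg_summable : Summable fun n => g (r n) :=
    .of_norm_bounded (hr_summable.mul_left C) fun n => hg_norm (r n)
  have hQ_partial (n : ℕ) : ∑ i ∈ Finset.range n, Q (g (r i)) = y - r n :=
    (Finset.sum_congr rfl fun i _ => by rw [hr_succ, sub_sub_cancel]).trans
      (Finset.sum_range_sub' r n)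
  have hr_lim : Tendsto r atTop (𝓝 0) :=
    tendsto_zero_iff_norm_tendsto_zero.2 hr_summable.tendsto_atTop_zero
  refine ⟨∑' n, g (r n), tendsto_nhds_unique (hg_summable.hasSum.mapL Q).tendsto_sum_nat ?_⟩
  simpa only [hQ_partial, sub_zero] using hr_lim.const_sub y

variable {𝕜 : Type*} [RCLike 𝕜]
variable {E : Type*} [NormedAddCommGroup E] [NormedSpace 𝕜 E] [CompleteSpace E]
variable {F : Type*} [NormedAddCommGroup F] [NormedSpace 𝕜 F] [CompleteSpace F]

theorem quotientInverse_apply (Q : E →L[𝕜] F) (hQ : Function.Surjective Q) (x : E) :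
    quotientInverse Q hQ (Q x) = Submodule.Quotient.mk x :=
  (Q : E →ₗ[𝕜] F).quotKerEquivOfSurjective_symm_apply hQ x

theorem exists_surjective_inversionConstant_le {Q : E →L[𝕜] F} {C : ℝ} (hC : 0 ≤ C)
    (hQ : ∀ y, y ∈ closure (Q '' Metric.closedBall 0 (C * ‖y‖))) :
    ∃ h : Function.Surjective Q, inversionConstant Q h ≤ C := by
  refine ⟨surjective_of_mem_closure_image_closedBall hQ,
    ContinuousLinearMap.opNorm_le_bound _ hC fun y => ?_⟩
  refine closure_minimal (t := {z | ‖quotientInverse Q _ z‖ ≤ C * ‖y‖}) ?_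
    (isClosed_le (by fun_prop) (by fun_prop)) (hQ y)
  rintro _ ⟨x, hx, rfl⟩
  rw [Set.mem_ofPred_eq, quotientInverse_apply]
  exact (Submodule.Quotient.norm_mk_le _ x).trans (mem_closedBall_zero_iff.1 hx)

end Inversion

section Approximable

variable {𝕜 : Type*} [RCLike 𝕜]
variable {W : Type*} [NormedAddCommGroup W] [NormedSpace 𝕜 W]
variable {X : Type*} [NormedAddCommGroup X] [NormedSpace 𝕜 X]
variable {Y : Type*} [NormedAddCommGroup Y] [NormedSpace 𝕜 Y]
variable {Z : Type*} [NormedAddCommGroup Z] [NormedSpace 𝕜 Z]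

theorem comp_mem_approximable_right {R : Y →L[𝕜] Z} (hR : R ∈ approximable 𝕜 Y Z)
    (S : X →L[𝕜] Y) : R.comp S ∈ approximable 𝕜 X Z := by
  refine map_mem_closure (f := fun T : Y →L[𝕜] Z => T.comp S)
    ((ContinuousLinearMap.compL 𝕜 X Y Z).flip S).continuous hR fun T hT => ?_
  have : FiniteDimensional 𝕜 (LinearMap.range (T : Y →ₗ[𝕜] Z)) := hT
  exact Submodule.finiteDimensional_of_le
    (LinearMap.range_comp_le_range (S : X →ₗ[𝕜] Y) (T : Y →ₗ[𝕜] Z))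

theorem smulRight_mem_approximable (f : X →L[𝕜] 𝕜) (y : Y) :
    f.smulRight y ∈ approximable 𝕜 X Y := by
  refine Submodule.le_topologicalClosure _ ?_
  refine Submodule.finiteDimensional_of_le (S₂ := 𝕜 ∙ y) ?_
  rintro _ ⟨x, rfl⟩
  exact Submodule.smul_mem _ _ (Submodule.mem_span_singleton_self y)

/-- The rank-one operator `x ↦ f x • y` as an element of `A(X, Y)`. -/
def Approx.rankOne (f : X →L[𝕜] 𝕜) (y : Y) : Approx 𝕜 X Y :=
  ⟨f.smulRight y, smulRight_mem_approximable f y⟩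

theorem Approx.val_rankOne (f : X →L[𝕜] 𝕜) (y : Y) :
    Approx.val 𝕜 X Y (Approx.rankOne f y) = f.smulRight y := rfl

/-- The ideal property of approximable operators: `T ↦ S ∘ T ∘ R` as a bounded linear map
`A(X, Y) → A(W, Z)`. -/
def Approx.sandwich (S : Y →L[𝕜] Z) (R : W →L[𝕜] X) : Approx 𝕜 X Y →L[𝕜] Approx 𝕜 W Z :=
  (((ContinuousLinearMap.compL 𝕜 W Y Z S).comp ((ContinuousLinearMap.compL 𝕜 W X Y).flip R)).comp
    (Approx.val 𝕜 X Y).toContinuousLinearMap).codRestrict (approximable 𝕜 W Z)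
    fun T => comp_mem_approximable_left S (comp_mem_approximable_right T.2 R)

theorem Approx.val_sandwich (S : Y →L[𝕜] Z) (R : W →L[𝕜] X) (T : Approx 𝕜 X Y) :
    Approx.val 𝕜 W Z (Approx.sandwich S R T) = S.comp ((Approx.val 𝕜 X Y T).comp R) := rfl

theorem Approx.norm_sandwich_le (S : Y →L[𝕜] Z) (R : W →L[𝕜] X) :
    ‖Approx.sandwich S R‖ ≤ ‖S‖ * ‖R‖ := by
  refine ContinuousLinearMap.opNorm_le_bound _ (by positivity) fun T => ?_
  rw [← (Approx.val 𝕜 W Z).norm_map, ← (Approx.val 𝕜 X Y).norm_map, Approx.val_sandwich]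
  calc ‖S.comp ((Approx.val 𝕜 X Y T).comp R)‖
      ≤ ‖S‖ * (‖Approx.val 𝕜 X Y T‖ * ‖R‖) :=
        (S.opNorm_comp_le _).trans (by gcongr; exact ContinuousLinearMap.opNorm_comp_le _ _)
    _ = ‖S‖ * ‖R‖ * ‖Approx.val 𝕜 X Y T‖ := by ring

theorem norm_map_sandwich_le (p : X →L[𝕜] Y) (j : Z →L[𝕜] X) (q : X →L[𝕜] Z) (i : Y →L[𝕜] X)
    (a : Approx 𝕜 Y Y) {d : ProjTensor 𝕜 (Approx 𝕜 X X) (Approx 𝕜 X X)} {K : ℝ} (hd : ‖d‖ ≤ K) :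
    ‖ProjTensor.map (Approx.sandwich p j) (Approx.sandwich q (i.comp (Approx.val 𝕜 Y Y a))) d‖ ≤
      K * ‖i‖ * ‖p‖ * ‖j‖ * ‖q‖ * ‖a‖ := by
  have h_comp : ‖i.comp (Approx.val 𝕜 Y Y a)‖ ≤ ‖i‖ * ‖a‖ := by
    simpa only [LinearIsometry.norm_map] using i.opNorm_comp_le (Approx.val 𝕜 Y Y a)
  calc _ ≤ ‖Approx.sandwich (X := X) (Y := X) p j‖ *
          ‖Approx.sandwich (X := X) (Y := X) q (i.comp (Approx.val 𝕜 Y Y a))‖ * ‖d‖ :=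
        ContinuousLinearMap.le_of_opNorm_le _ (ProjTensor.norm_map_le _ _) d
    _ ≤ (‖p‖ * ‖j‖) * (‖q‖ * (‖i‖ * ‖a‖)) * K := by
        gcongr
        · exact Approx.norm_sandwich_le p j
        · exact (Approx.norm_sandwich_le q _).trans (by gcongr)
    _ = K * ‖i‖ * ‖p‖ * ‖j‖ * ‖q‖ * ‖a‖ := by ring

end Approximable

section StrongConvergence

variable {𝕜 : Type*} [NontriviallyNormedField 𝕜]
variable {X : Type*} [NormedAddCommGroup X] [NormedSpace 𝕜 X]
variable {Y : Type*} [NormedAddCommGroup Y] [NormedSpace 𝕜 Y]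
variable {ι : Type*}

theorem tendsto_clm_of_tendsto_apply [CompleteSpace 𝕜] [FiniteDimensional 𝕜 X] {l : Filter ι}
    {M : ι → X →L[𝕜] Y} {M₀ : X →L[𝕜] Y} (h : ∀ x, Tendsto (fun i => M i x) l (𝓝 (M₀ x))) :
    Tendsto M l (𝓝 M₀) := by
  let e : (X →L[𝕜] Y) ≃L[𝕜] Fin (Module.finrank 𝕜 X) → Y :=
    ((ContinuousLinearEquiv.ofFinrankEq (Module.finrank_fin_fun 𝕜).symm).arrowCongr
      (1 : Y ≃L[𝕜] Y)).trans (ContinuousLinearEquiv.piRing _)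
  rw [e.toHomeomorph.isInducing.tendsto_nhds_iff]
  exact tendsto_pi_nhds.2 fun j => h _

theorem exists_tendsto_smul_of_asymptotically_commute [ProperSpace 𝕜] [SeparatingDual 𝕜 X]
    (l : Ultrafilter ι) {M : ι → X →L[𝕜] X} {C : ℝ} (hM : ∀ i, ‖M i‖ ≤ C)
    (hcomm : ∀ (f : X →L[𝕜] 𝕜) (x : X),
      Tendsto (fun i => (f.smulRight x).comp (M i) - (M i).comp (f.smulRight x)) l (𝓝 0)) :
    ∃ c : 𝕜, ∀ x, Tendsto (fun i => M i x) l (𝓝 (c • x)) := by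
  rcases subsingleton_or_nontrivial X with _ | _
  · exact ⟨0, fun x => by simpa only [Subsingleton.elim _ (0 : X)] using tendsto_const_nhds⟩
  obtain ⟨x₀, hx₀⟩ := exists_ne (0 : X)
  obtain ⟨f, hf⟩ := SeparatingDual.exists_eq_one (R := 𝕜) hx₀
  have h_bounded (i : ι) : f (M i x₀) ∈ Metric.closedBall (0 : 𝕜) (‖f‖ * (C * ‖x₀‖)) :=
    mem_closedBall_zero_iff.2 (f.le_opNorm_of_le ((M i).le_of_opNorm_le (hM i) x₀))
  obtain ⟨c, -, hc⟩ := (isCompact_closedBall (0 : 𝕜) _).ultrafilter_le_nhds'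
    (l.map fun i => f (M i x₀)) (Eventually.of_forall (f := (l : Filter ι)) h_bounded)
  refine ⟨c, fun x => ?_⟩
  -- Evaluated at `x₀`, the commutator with `f.smulRight x` is `f (M i x₀) • x - M i x`.
  have h_comm : Tendsto (fun i => f (M i x₀) • x - M i x) l (𝓝 0) := by
    simpa [Function.comp_def, hf] using
      ((ContinuousLinearMap.apply 𝕜 X x₀).continuous.tendsto 0).comp (hcomm f x)
  have h_scalar : Tendsto (fun i => f (M i x₀) • x) l (𝓝 (c • x)) :=
    Tendsto.smul_const (f := fun i => f (M i x₀)) hc x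
  simpa using h_scalar.sub h_comm

end StrongConvergence

section ApproximableStrongConvergence

variable {𝕜 : Type*} [RCLike 𝕜]
variable {X : Type*} [NormedAddCommGroup X] [NormedSpace 𝕜 X]
variable {Y : Type*} [NormedAddCommGroup Y] [NormedSpace 𝕜 Y]
variable {Z : Type*} [NormedAddCommGroup Z] [NormedSpace 𝕜 Z]
variable {ι : Type*}

theorem tendsto_comp_of_mem_finiteRank {l : Filter ι} {M : ι → Y →L[𝕜] Z} {M₀ : Y →L[𝕜] Z}
    (h : ∀ y, Tendsto (fun i => M i y) l (𝓝 (M₀ y))) {a : X →L[𝕜] Y} (ha : a ∈ finiteRank 𝕜 X Y) :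
    Tendsto (fun i => (M i).comp a) l (𝓝 (M₀.comp a)) := by
  have : FiniteDimensional 𝕜 a.range := ha
  have h_range : Tendsto (fun i => (M i).comp a.range.subtypeL) l (𝓝 (M₀.comp a.range.subtypeL)) :=
    tendsto_clm_of_tendsto_apply fun y => h y
  exact (((ContinuousLinearMap.compL 𝕜 X a.range Z).flip a.rangeRestrict).continuous.tendsto _).comp
    h_range

theorem tendsto_comp_of_mem_approximable {l : Filter ι} {M : ι → Y →L[𝕜] Z} {M₀ : Y →L[𝕜] Z}
    {C : ℝ} (hM : ∀ i, ‖M i‖ ≤ C) (h : ∀ y, Tendsto (fun i => M i y) l (𝓝 (M₀ y))) {a : X →L[𝕜] Y}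
    (ha : a ∈ approximable 𝕜 X Y) : Tendsto (fun i => (M i).comp a) l (𝓝 (M₀.comp a)) := by
  have h_lipschitz (i : ι) : LipschitzWith C.toNNReal fun b : X →L[𝕜] Y => (M i).comp b :=
    LipschitzWith.of_dist_le_mul fun b b' => by
      rw [dist_eq_norm, dist_eq_norm, ← ContinuousLinearMap.comp_sub]
      exact ((M i).opNorm_comp_le _).trans (by gcongr; exact (hM i).trans (Real.le_coe_toNNReal C))
  have h_closed : IsClosed {b : X →L[𝕜] Y | Tendsto (fun i => (M i).comp b) l (𝓝 (M₀.comp b))} :=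
    (LipschitzWith.uniformEquicontinuous _ _ h_lipschitz).equicontinuous.isClosed_setOfPred_tendsto
      (ContinuousLinearMap.compL 𝕜 X Y Z M₀).continuous
  exact closure_minimal (fun b hb => tendsto_comp_of_mem_finiteRank h hb) h_closed ha

theorem tendsto_val_apply_of_tendsto_mul {l : Filter ι} {e : ι → Approx 𝕜 X X}
    (he : ∀ a, Tendsto (fun i => e i * a) l (𝓝 a)) (x : X) :
    Tendsto (fun i => Approx.val 𝕜 X X (e i) x) l (𝓝 x) := by
  rcases eq_or_ne x 0 with rfl | hx
  · simpa only [map_zero] using tendsto_const_nhds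
  · obtain ⟨f, hf⟩ := SeparatingDual.exists_eq_one (R := 𝕜) hx
    have h_val := ((Approx.val 𝕜 X X).continuous.tendsto _).comp (he (Approx.rankOne f x))
    have h_apply := ((ContinuousLinearMap.apply 𝕜 X x).continuous.tendsto _).comp h_val
    simpa [Function.comp_def, Approx.mul_eq_comp, Approx.val_comp, Approx.val_rankOne, hf]
      using h_apply

end ApproximableStrongConvergence

section CompThrough

variable {𝕜 : Type*} [RCLike 𝕜]
variable {W : Type*} [NormedAddCommGroup W] [NormedSpace 𝕜 W]
variable {X : Type*} [NormedAddCommGroup X] [NormedSpace 𝕜 X]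
variable {Y : Type*} [NormedAddCommGroup Y] [NormedSpace 𝕜 Y]
variable {Z : Type*} [NormedAddCommGroup Z] [NormedSpace 𝕜 Z] [CompleteSpace Z]

/-- Composition through `T : W → Y`: the bounded linear map `A(Y, Z) ⊗̂ A(X, W) → L(X, Z)` sending
`R ⊗ S` to `R ∘ T ∘ S`. -/
def compThrough (T : W →L[𝕜] Y) :
    ProjTensor 𝕜 (Approx 𝕜 Y Z) (Approx 𝕜 X W) →L[𝕜] X →L[𝕜] Z :=
  lift ((ContinuousLinearMap.compL 𝕜 X Y Z).bilinearComp
    (Approx.val 𝕜 Y Z).toContinuousLinearMap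
    ((ContinuousLinearMap.compL 𝕜 X W Y T).comp (Approx.val 𝕜 X W).toContinuousLinearMap))

theorem compThrough_ptmul (T : W →L[𝕜] Y) (R : Approx 𝕜 Y Z) (S : Approx 𝕜 X W) :
    compThrough T (ptmul 𝕜 R S) = (Approx.val 𝕜 Y Z R).comp (T.comp (Approx.val 𝕜 X W S)) :=
  lift_ptmul _ R S

theorem compThrough_sub (T T' : W →L[𝕜] Y) (d : ProjTensor 𝕜 (Approx 𝕜 Y Z) (Approx 𝕜 X W)) :
    compThrough (T - T') d = compThrough T d - compThrough T' d := by
  refine DFunLike.congr_fun (g := compThrough T - compThrough T')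
    (ProjTensor.clm_ext fun R S => ?_) d
  simp only [sub_apply, compThrough_ptmul, ContinuousLinearMap.sub_comp,
    ContinuousLinearMap.comp_sub]

end CompThrough

theorem IsKAmenable.nonneg {𝕜 : Type*} [RCLike 𝕜] {A : Type*} [NonUnitalNormedRing A]
    [NormedSpace 𝕜 A] [IsScalarTower 𝕜 A A] [SMulCommClass 𝕜 A A] [CompleteSpace A] {K : ℝ}
    (hK : IsKAmenable 𝕜 A K) : 0 ≤ K := by
  obtain ⟨ι, _, _, _, d, hd, -, -⟩ := hK
  exact (norm_nonneg _).trans (hd (Classical.arbitrary ι))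

section CompThroughAlgebra

variable {𝕜 : Type*} [RCLike 𝕜]
variable {X : Type*} [NormedAddCommGroup X] [NormedSpace 𝕜 X] [CompleteSpace X]
variable {Y : Type*} [NormedAddCommGroup Y] [NormedSpace 𝕜 Y]
variable {Z : Type*} [NormedAddCommGroup Z] [NormedSpace 𝕜 Z]

theorem compThrough_one (d : ProjTensor 𝕜 (Approx 𝕜 X X) (Approx 𝕜 X X)) :
    compThrough 1 d = Approx.val 𝕜 X X (mulMap 𝕜 (Approx 𝕜 X X) d) := by
  refine DFunLike.congr_fun
    (g := (Approx.val 𝕜 X X).toContinuousLinearMap.comp (mulMap 𝕜 (Approx 𝕜 X X)))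
    (ProjTensor.clm_ext fun R S => ?_) d
  rw [compThrough_ptmul, ContinuousLinearMap.comp_apply, mulMap, lift_ptmul]
  rfl

theorem compThrough_leftAct (T : X →L[𝕜] X) (a : Approx 𝕜 X X)
    (d : ProjTensor 𝕜 (Approx 𝕜 X X) (Approx 𝕜 X X)) :
    compThrough T (leftAct 𝕜 a d) = (Approx.val 𝕜 X X a).comp (compThrough T d) := by
  refine DFunLike.congr_fun (f := (compThrough T).comp (leftAct 𝕜 a))
    (g := (ContinuousLinearMap.compL 𝕜 X X X (Approx.val 𝕜 X X a)).comp (compThrough T))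
    (ProjTensor.clm_ext fun R S => ?_) d
  simp only [ContinuousLinearMap.comp_apply, leftAct_ptmul, compThrough_ptmul,
    ContinuousLinearMap.compL_apply]
  rfl

theorem compThrough_rightAct (T : X →L[𝕜] X) (a : Approx 𝕜 X X)
    (d : ProjTensor 𝕜 (Approx 𝕜 X X) (Approx 𝕜 X X)) :
    compThrough T (rightAct 𝕜 a d) = (compThrough T d).comp (Approx.val 𝕜 X X a) := by
  refine DFunLike.congr_fun (f := (compThrough T).comp (rightAct 𝕜 a))
    (g := ((ContinuousLinearMap.compL 𝕜 X X X).flip (Approx.val 𝕜 X X a)).comp (compThrough T))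
    (ProjTensor.clm_ext fun R S => ?_) d
  simp only [ContinuousLinearMap.comp_apply, rightAct_ptmul, compThrough_ptmul,
    ContinuousLinearMap.flip_apply, ContinuousLinearMap.compL_apply]
  rfl

theorem exists_tendsto_compThrough_smul {ι : Type*} (l : Ultrafilter ι)
    {d : ι → ProjTensor 𝕜 (Approx 𝕜 X X) (Approx 𝕜 X X)} {K : ℝ} (hd : ∀ i, ‖d i‖ ≤ K)
    (hcomm : ∀ a, Tendsto (fun i => leftAct 𝕜 a (d i) - rightAct 𝕜 a (d i)) l (𝓝 0))
    (T : X →L[𝕜] X) :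
    ∃ c : 𝕜, ∀ x, Tendsto (fun i => compThrough T (d i) x) l (𝓝 (c • x)) := by
  refine exists_tendsto_smul_of_asymptotically_commute l
    (fun i => (compThrough T).le_opNorm_of_le (hd i)) fun f x => ?_
  simpa only [Function.comp_def, map_sub, map_zero, compThrough_leftAct, compThrough_rightAct,
    Approx.val_rankOne] using
    ((compThrough T).continuous.tendsto 0).comp (hcomm (Approx.rankOne f x))

theorem IsKAmenable.exists_tendsto_compThrough_smul.{u} {X : Type u} [NormedAddCommGroup X]
    [NormedSpace 𝕜 X] [CompleteSpace X] {K : ℝ} (hK : IsKAmenable 𝕜 (Approx 𝕜 X X) K)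
    (T : X →L[𝕜] X) :
    ∃ (ι : Type u) (l : Ultrafilter ι) (d : ι → ProjTensor 𝕜 (Approx 𝕜 X X) (Approx 𝕜 X X))
      (c : 𝕜),
      (∀ i, ‖d i‖ ≤ K) ∧
      (∀ x, Tendsto (fun i => compThrough T (d i) x) l (𝓝 (c • x))) ∧
      (∀ x, Tendsto (fun i => compThrough (1 - T) (d i) x) l (𝓝 ((1 - c) • x))) := by
  obtain ⟨ι, _, _, _, d, hd, hπ, hcomm⟩ := hK
  let l : Ultrafilter ι := .of atTop
  have hl : (l : Filter ι) ≤ atTop := Ultrafilter.of_le _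
  obtain ⟨c, hc⟩ :=
    ApproxOp.exists_tendsto_compThrough_smul l hd (fun a => (hcomm a).mono_left hl) T
  refine ⟨ι, l, d, c, hd, hc, fun x => ?_⟩
  have h_one : Tendsto (fun i => compThrough 1 (d i) x) l (𝓝 x) := by
    simpa only [compThrough_one] using
      (tendsto_val_apply_of_tendsto_mul hπ x).mono_left hl
  simpa only [compThrough_sub, sub_apply, sub_smul, one_smul] using h_one.sub (hc x)

variable [CompleteSpace Y]

theorem val_productMap_map_sandwich (p : X →L[𝕜] Y) (j : Z →L[𝕜] X) (q : X →L[𝕜] Z) (r : Y →L[𝕜] X)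
    (d : ProjTensor 𝕜 (Approx 𝕜 X X) (Approx 𝕜 X X)) :
    Approx.val 𝕜 Y Y
        (productMap 𝕜 Y Z (ProjTensor.map (Approx.sandwich p j) (Approx.sandwich q r) d)) =
      p.comp ((compThrough (j.comp q) d).comp r) := by
  refine DFunLike.congr_fun
    (f := (Approx.val 𝕜 Y Y).toContinuousLinearMap.comp
      ((productMap 𝕜 Y Z).comp (ProjTensor.map (Approx.sandwich p j) (Approx.sandwich q r))))
    (g := (ContinuousLinearMap.compL 𝕜 Y X Y p).comp
      (((ContinuousLinearMap.compL 𝕜 Y X X).flip r).comp (compThrough (j.comp q))))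
    (ProjTensor.clm_ext fun R S => ?_) d
  simp only [ContinuousLinearMap.comp_apply, ProjTensor.map_ptmul, productMap_ptmul,
    compThrough_ptmul, ContinuousLinearMap.flip_apply, ContinuousLinearMap.compL_apply]
  rfl

theorem exists_inversionConstant_productMap_le {ι : Type*} {l : Filter ι} [l.NeBot]
    {d : ι → ProjTensor 𝕜 (Approx 𝕜 X X) (Approx 𝕜 X X)} {K : ℝ} (hd : ∀ n, ‖d n‖ ≤ K)
    {i : Y →L[𝕜] X} {p : X →L[𝕜] Y} (hpi : p.comp i = 1) {j : Z →L[𝕜] X} {q : X →L[𝕜] Z}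
    {c : 𝕜} {C : ℝ} (hc : 1 ≤ C * ‖c‖)
    (h : ∀ x, Tendsto (fun n => compThrough (j.comp q) (d n) x) l (𝓝 (c • x))) :
    ∃ hs : Function.Surjective (productMap 𝕜 Y Z),
      inversionConstant (productMap 𝕜 Y Z) hs ≤ C * K * ‖i‖ * ‖p‖ * ‖j‖ * ‖q‖ := by
  have hK : 0 ≤ K := by
    obtain ⟨n⟩ := l.nonempty_of_neBot
    exact (norm_nonneg _).trans (hd n)
  have hc_ne_zero : c ≠ 0 := by
    rintro rfl
    norm_num at hc
  have hc_inv : ‖c‖⁻¹ ≤ C := (inv_le_iff_one_le_mul₀ (norm_pos_iff.2 hc_ne_zero)).2 hc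
  have hC : 0 ≤ C := (inv_nonneg.2 (norm_nonneg c)).trans hc_inv
  refine exists_surjective_inversionConstant_le (by positivity) fun a => ?_
  let r : Y →L[𝕜] X := i.comp (Approx.val 𝕜 Y Y a)
  let t (n : ι) : ProjTensor 𝕜 (Approx 𝕜 Z Y) (Approx 𝕜 Y Z) :=
    c⁻¹ • ProjTensor.map (Approx.sandwich p j) (Approx.sandwich q r) (d n)
  have ht_norm (n : ι) : ‖t n‖ ≤ C * K * ‖i‖ * ‖p‖ * ‖j‖ * ‖q‖ * ‖a‖ :=
    calc ‖t n‖ ≤ C * (K * ‖i‖ * ‖p‖ * ‖j‖ * ‖q‖ * ‖a‖) := by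
          rw [norm_smul, norm_inv]
          gcongr
          exact norm_map_sandwich_le p j q i a (hd n)
      _ = C * K * ‖i‖ * ‖p‖ * ‖j‖ * ‖q‖ * ‖a‖ := by ring
  have h_comp : Tendsto (fun n => (compThrough (j.comp q) (d n)).comp r) l (𝓝 (c • r)) :=
    tendsto_comp_of_mem_approximable (M₀ := c • ContinuousLinearMap.id 𝕜 X)
      (fun n => (compThrough (j.comp q)).le_opNorm_of_le (hd n)) h
      (comp_mem_approximable_left i a.2)
  have h_limit : c⁻¹ • p.comp (c • r) = Approx.val 𝕜 Y Y a := by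
    rw [ContinuousLinearMap.comp_smul, inv_smul_smul₀ hc_ne_zero,
      ← ContinuousLinearMap.comp_assoc, hpi]
    rfl
  have ht_lim : Tendsto (fun n => productMap 𝕜 Y Z (t n)) l (𝓝 a) := by
    rw [(Approx.val 𝕜 Y Y).isometry.isUniformInducing.isInducing.tendsto_nhds_iff, ← h_limit]
    simp only [Function.comp_def, t, map_smul, val_productMap_map_sandwich]
    exact (((ContinuousLinearMap.compL 𝕜 Y X Y p).continuous.tendsto _).comp h_comp).const_smul c⁻¹
  exact mem_closure_of_tendsto ht_lim <| .of_forall fun n =>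
    Set.mem_image_of_mem _ (mem_closedBall_zero_iff.2 (ht_norm n))

end CompThroughAlgebra

theorem one_le_two_mul_norm_or_one_le_two_mul_norm_one_sub {R : Type*} [SeminormedRing R]
    [NormOneClass R] (c : R) : 1 ≤ 2 * ‖c‖ ∨ 1 ≤ 2 * ‖1 - c‖ := by
  by_contra! h
  have h_one : ‖(1 : R)‖ ≤ ‖1 - c‖ + ‖c‖ := by
    simpa only [sub_add_cancel] using norm_add_le (1 - c) c
  rw [norm_one] at h_one
  linarith [h.1, h.2]

theorem one_le_norm_of_isIdempotentElem {R : Type*} [NonUnitalNormedRing R] {p : R}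
    (hp : IsIdempotentElem p) (h : p ≠ 0) : 1 ≤ ‖p‖ := by
  refine le_of_mul_le_mul_right ?_ (norm_pos_iff.2 h)
  simpa only [one_mul, hp.eq] using norm_mul_le p p

section Projection

variable {𝕜 : Type*} [NontriviallyNormedField 𝕜]
variable {X : Type*} [NormedAddCommGroup X] [NormedSpace 𝕜 X]
variable {Y : Type*} [NormedAddCommGroup Y] [NormedSpace 𝕜 Y]

theorem norm_rangeRestrict_le (T : X →L[𝕜] Y) : ‖T.rangeRestrict‖ ≤ ‖T‖ :=
  ContinuousLinearMap.opNorm_le_bound _ (norm_nonneg T) T.le_opNorm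

theorem rangeRestrict_comp_subtypeL {P : X →L[𝕜] X} (hP : IsIdempotentElem P) :
    P.rangeRestrict.comp P.range.subtypeL = 1 := by
  ext ⟨_, x, rfl⟩
  exact DFunLike.congr_fun hP.eq x

theorem mul_norm_subtypeL_mul_norm_rangeRestrict_le {P : X →L[𝕜] X} (hP : IsIdempotentElem P)
    {K : ℝ} (hK : 0 ≤ K) :
    2 * K * ‖P.range.subtypeL‖ * ‖P.rangeRestrict‖ * ‖(1 - P).range.subtypeL‖ *
        ‖(1 - P).rangeRestrict‖ ≤
      4 * K * ‖P‖ * ‖1 - P‖ * max (‖P‖ ^ 3) (‖1 - P‖ ^ 3) := by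
  calc _ ≤ 2 * K * 1 * ‖P‖ * 1 * ‖1 - P‖ := by
        gcongr
        · exact P.range.norm_subtypeL_le
        · exact norm_rangeRestrict_le P
        · exact (1 - P).range.norm_subtypeL_le
        · exact norm_rangeRestrict_le (1 - P)
    _ ≤ 4 * K * ‖P‖ * ‖1 - P‖ * max (‖P‖ ^ 3) (‖1 - P‖ ^ 3) := by
        rcases eq_or_ne P 0 with rfl | h
        · simp
        have h_max : 1 ≤ max (‖P‖ ^ 3) (‖1 - P‖ ^ 3) :=
          le_max_of_le_left (one_le_pow₀ (one_le_norm_of_isIdempotentElem hP h))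
        have h_nonneg : 0 ≤ K * ‖P‖ * ‖1 - P‖ := by positivity
        nlinarith

end Projection

end ApproxOp

end

open ApproxOp in
theorem mainTheorem5_general {𝕜 : Type*} [RCLike 𝕜]
    {X : Type*} [NormedAddCommGroup X] [NormedSpace 𝕜 X] [CompleteSpace X]
    {Y : Type*} [NormedAddCommGroup Y] [NormedSpace 𝕜 Y] [CompleteSpace Y]
    {Z : Type*} [NormedAddCommGroup Z] [NormedSpace 𝕜 Z] [CompleteSpace Z]
    {i : Y →L[𝕜] X} {p : X →L[𝕜] Y} {j : Z →L[𝕜] X} {q : X →L[𝕜] Z}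
    (hpi : p.comp i = 1) (hqj : q.comp j = 1) (hsum : i.comp p + j.comp q = 1)
    {K : ℝ} (hK : IsKAmenable 𝕜 (Approx 𝕜 X X) K) :
    (∃ h : Function.Surjective (productMap 𝕜 Y Z),
      inversionConstant (productMap 𝕜 Y Z) h ≤ 2 * K * ‖i‖ * ‖p‖ * ‖j‖ * ‖q‖) ∨
    (∃ h : Function.Surjective (productMap 𝕜 Z Y),
      inversionConstant (productMap 𝕜 Z Y) h ≤ 2 * K * ‖i‖ * ‖p‖ * ‖j‖ * ‖q‖) := by
  obtain ⟨ι, l, d, c, hd, hZ, hY⟩ := hK.exists_tendsto_compThrough_smul (j.comp q)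
  rw [← hsum, add_sub_cancel_right] at hY
  rcases one_le_two_mul_norm_or_one_le_two_mul_norm_one_sub c with hc | hc
  · exact .inl (exists_inversionConstant_productMap_le hd hpi hc hZ)
  · obtain ⟨h, hb⟩ := exists_inversionConstant_productMap_le hd hqj hc hY
    exact .inr ⟨h, hb.trans_eq (by ring)⟩

open ApproxOp in
theorem mainTheorem5 {𝕜 : Type*} [RCLike 𝕜] {X : Type*} [NormedAddCommGroup X] [NormedSpace 𝕜 X]
    [CompleteSpace X] (P : X →L[𝕜] X) (hP : IsIdempotentElem P) (K : ℝ)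
    (hK : IsKAmenable 𝕜 (Approx 𝕜 X X) K) :
    haveI : CompleteSpace (rg P) := completeSpace_rg hP
    haveI : CompleteSpace (rg (1 - P)) := completeSpace_rg hP.one_sub
    (∃ h : Function.Surjective (productMap 𝕜 (rg P) (rg (1 - P))),
      inversionConstant (productMap 𝕜 (rg P) (rg (1 - P))) h
        ≤ 4 * K * ‖P‖ * ‖1 - P‖ * max (‖P‖ ^ 3) (‖1 - P‖ ^ 3)) ∨
    (∃ h : Function.Surjective (productMap 𝕜 (rg (1 - P)) (rg P)),
      inversionConstant (productMap 𝕜 (rg (1 - P)) (rg P)) h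
        ≤ 4 * K * ‖P‖ * ‖1 - P‖ * max (‖P‖ ^ 3) (‖1 - P‖ ^ 3)) := by
  have := completeSpace_rg hP
  have := completeSpace_rg hP.one_sub
  have h_le := mul_norm_subtypeL_mul_norm_rangeRestrict_le hP hK.nonneg
  have h_sum : (rg P).subtypeL.comp P.rangeRestrict +
      (rg (1 - P)).subtypeL.comp (1 - P).rangeRestrict = 1 := add_sub_cancel P 1
  exact (mainTheorem5_general (rangeRestrict_comp_subtypeL hP)
    (rangeRestrict_comp_subtypeL hP.one_sub) h_sum hK).imp
    (fun ⟨h, hb⟩ => ⟨h, hb.trans h_le⟩) (fun ⟨h, hb⟩ => ⟨h, hb.trans h_le⟩)
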